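/- Let $e$ be an algebraically closed field of characteristic $0$, let $n\ge 1$ be odd, and let $\mu_n\subset e^*$ be the group of $n$-th roots of unity. Let $K\subset e$ be the subfield generated over $\mathbb{Q}$ by $\mu_n$ and by the square roots $\sqrt p$ of the primes $p$ dividing $n$, and let $\iota:\mu_n\hookrightarrow K^*$ be the inclusion. A symplectic module is a finite abelian group $M$ of exponent $n$ with an alternating bilinear form $\omega:M\times M\to\mu_n$ (so $\omega(m,m)=1$) for which the induced map $M\to \mathrm{Hom}(M,e^*)$ is an isomorphism. Let $\beta$ be the unique alternating bilinear form $M\times M\to\mu_n$ with $\beta^2=\omega$. The (unique) symmetric Heisenberg extension $1\to\mu_n\to H(M)\to M\to 1$ with commutator $\omega$ is $H(M)=M\times\mu_n$ with the product $(m_1,a_1)(m_2,a_2)=(m_1+m_2,\,a_1a_2\,\beta(m_1,m_2))$. A symplectic isomorphism $f:M\to M'$ is an isomorphism of groups that carries $\omega$ to $\omega'$; it induces $H(f):H(M)\to H(M')$, $(m,a)\mapsto (f(m),a)$. Let $\mathrm{Sp}(M)$ be the group of symplectic automorphisms of $M$; it acts on $H(M)$ in this way. For a Lagrangian subgroup $L=L^\perp$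 of $M$ let $\mathcal{H}_L$ be the $K$-vector space of functions $\varphi:H(M)\to K$ with $\varphi((l,a)h)=a\,\varphi(h)$ for $l\in L$, $a\in\mu_n$, $h\in H(M)$, on which $H(M)$ acts by right translations. Theorem. There is an irreducible representation $\pi_M$ of $H(M)$ over $K$ with central character $\iota$, for each symplectic module $M$ of exponent $n$, that is canonical (defined up to a unique isomorphism) in the following sense. One can choose $\pi_M$ for all $M$, together with a $K$-linear isomorphism $T_f:\pi_M\to\pi_{M'}$ for every symplectic isomorphism $f:M\to M'$ and an isomorphism of $H(M)$-representations $t_L:\pi_M\to\mathcal{H}_L$ for every $M$ and every Lagrangian subgroup $L\subset M$, such that (i) $T_f(hv)=H(f)(h)\,T_f(v)$ for $h\in H(M)$, $v\in\pi_M$; $T_{\mathrm{id}}=\mathrm{id}$; and $T_{g\circ f}=T_g\circ T_f$; (ii) for every symplectic isomorphism $f:M\to M'$ and every Lagrangian subgroup $L\subset M$ there is a sign $s\in\{1,-1\}$ with $t_{f(L)}(T_f(v))(H(f)(h))=s\cdot t_L(v)(h)$ for all $v\in\pi_M$, $h\in H(M)$. Moreover, for every $M$ the $H(M)$-action on $\pi_M$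 extends to an action of $H(M)\rtimes\mathrm{Sp}(M)$ in which each $g\in\mathrm{Sp}(M)$ acts by $T_g$. -/

import Mathlib

universe u v

namespace FiniteHeisenberg

/-- The subfield `K ⊆ e` generated over `ℚ` by the `n`-th roots of unity and the square roots
of the primes dividing `n`. -/
noncomputable def coeffField (e : Type v) [Field e] [CharZero e] (n : ℕ) :
    IntermediateField ℚ e :=
  IntermediateField.adjoin ℚ ({x : e | x ^ n = 1} ∪ {x : e | ∃ p : ℕ, p.Prime ∧ p ∣ n ∧ x ^ 2 = p})

/-- The tautological character `ι : μ_n → K`. -/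
noncomputable def tautChar (e : Type v) [Field e] [CharZero e] (n : ℕ) :
    rootsOfUnity n e →* coeffField e n where
  toFun a := ⟨((a : eˣ) : e), IntermediateField.subset_adjoin ℚ _
    (Or.inl ((mem_rootsOfUnity' n _).1 a.2))⟩
  map_one' := rfl
  map_mul' _ _ := rfl

/-- A finite abelian group `M` of exponent `n` with a nondegenerate alternating bilinear form
`ω : M × M → μ_n ⊆ eˣ`. -/
structure SymplecticModule (e : Type v) [Field e] (n : ℕ) where
  /-- the underlying abelian group, written additively -/
  M : Type u
  [addCommGroup : AddCommGroup M]
  [finite : Finite M]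
  exponent_eq : AddMonoid.exponent M = n
  /-- the form `ω` -/
  form : M → M → rootsOfUnity n e
  form_add_left : ∀ x y z, form (x + y) z = form x z * form y z
  form_add_right : ∀ x y z, form x (y + z) = form x y * form x z
  form_self : ∀ x, form x x = 1
  /-- the induced map `M → Hom(M, eˣ)` is bijective -/
  nondegenerate : ∀ χ : Multiplicative M →* eˣ,
    ∃! x : M, ∀ y : M, χ (Multiplicative.ofAdd y) = (form x y : eˣ)

attribute [instance] SymplecticModule.addCommGroup SymplecticModule.finite

namespace SymplecticModule

variable {e : Type v} [Field e] {n : ℕ}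

/-- `β = ω ^ ((n + 1) / 2)`; for odd `n` this is the alternating bilinear form with `β² = ω`. -/
def halfForm (D : SymplecticModule.{u} e n) (x y : D.M) : rootsOfUnity n e :=
  D.form x y ^ ((n + 1) / 2)

theorem halfForm_sq (D : SymplecticModule.{u} e n) (hn : Odd n) (x y : D.M) :
    D.halfForm x y ^ 2 = D.form x y := by
  obtain ⟨k, rfl⟩ := hn
  have h : D.form x y ^ (2 * k + 1) = 1 :=
    Subtype.ext ((mem_rootsOfUnity _ _).1 (D.form x y).2)
  have h2 : (2 * k + 1 + 1) / 2 * 2 = (2 * k + 1) + 1 := by omega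
  rw [halfForm, ← pow_mul, h2, pow_succ, h, one_mul]

theorem halfForm_add_left (D : SymplecticModule.{u} e n) (x y z : D.M) :
    D.halfForm (x + y) z = D.halfForm x z * D.halfForm y z := by
  simp [halfForm, form_add_left, mul_pow]

theorem halfForm_add_right (D : SymplecticModule.{u} e n) (x y z : D.M) :
    D.halfForm x (y + z) = D.halfForm x y * D.halfForm x z := by
  simp [halfForm, form_add_right, mul_pow]

theorem halfForm_self (D : SymplecticModule.{u} e n) (x : D.M) : D.halfForm x x = 1 := by
  simp [halfForm, form_self]

theorem halfForm_zero_left (D : SymplecticModule.{u} e n) (x : D.M) : D.halfForm 0 x = 1 := by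
  have h := D.halfForm_add_left 0 0 x
  rw [add_zero] at h
  exact left_eq_mul.1 h

theorem halfForm_zero_right (D : SymplecticModule.{u} e n) (x : D.M) : D.halfForm x 0 = 1 := by
  have h := D.halfForm_add_right x 0 0
  rw [add_zero] at h
  exact left_eq_mul.1 h

theorem halfForm_neg_left (D : SymplecticModule.{u} e n) (x y : D.M) :
    D.halfForm (-x) y = (D.halfForm x y)⁻¹ := by
  rw [eq_inv_iff_mul_eq_one, ← D.halfForm_add_left, neg_add_cancel, D.halfForm_zero_left]

theorem halfForm_swap (D : SymplecticModule.{u} e n) (x y : D.M) :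
    D.halfForm y x = (D.halfForm x y)⁻¹ := by
  have h := D.halfForm_self (x + y)
  rw [halfForm_add_left, halfForm_add_right, halfForm_add_right, halfForm_self, halfForm_self,
    one_mul, mul_one] at h
  exact eq_inv_of_mul_eq_one_right h

/-- The Heisenberg group `H = M × μ_n`, the symmetric central extension of `M` by `μ_n`
with commutator `ω`. -/
@[ext] structure Heis (D : SymplecticModule.{u} e n) where
  /-- the component in `M` -/
  m : D.M
  /-- the component in `μ_n` -/
  a : rootsOfUnity n e

namespace Heis

variable {D : SymplecticModule.{u} e n}

/-- `(m₁, a₁) (m₂, a₂) = (m₁ + m₂, a₁ a₂ β(m₁, m₂))` -/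
instance : Mul (Heis D) := ⟨fun x y => ⟨x.m + y.m, x.a * y.a * D.halfForm x.m y.m⟩⟩
instance : One (Heis D) := ⟨⟨0, 1⟩⟩
instance : Inv (Heis D) := ⟨fun x => ⟨-x.m, x.a⁻¹⟩⟩

@[simp] theorem mul_m (x y : Heis D) : (x * y).m = x.m + y.m := rfl
@[simp] theorem mul_a (x y : Heis D) : (x * y).a = x.a * y.a * D.halfForm x.m y.m := rfl
@[simp] theorem one_m : (1 : Heis D).m = 0 := rfl
@[simp] theorem one_a : (1 : Heis D).a = 1 := rfl
@[simp] theorem inv_m (x : Heis D) : (x⁻¹).m = -x.m := rfl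
@[simp] theorem inv_a (x : Heis D) : (x⁻¹).a = x.a⁻¹ := rfl

instance : Group (Heis D) :=
  Group.ofLeftAxioms
    (fun x y z => by
      ext1
      · simp [add_assoc]
      · simp only [mul_a, mul_m, halfForm_add_left, halfForm_add_right]
        simp only [mul_assoc, mul_comm, mul_left_comm])
    (fun x => by ext1 <;> simp [halfForm_zero_left])
    (fun x => by ext1 <;> simp [halfForm_neg_left, halfForm_self])

/-- The central inclusion `μ_n → H`. -/
def incl (D : SymplecticModule.{u} e n) : rootsOfUnity n e →* Heis D where
  toFun a := ⟨0, a⟩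
  map_one' := rfl
  map_mul' a b := by ext1 <;> simp [halfForm_zero_left]

/-- The projection `H → M`. -/
def proj (D : SymplecticModule.{u} e n) : Heis D →* Multiplicative D.M where
  toFun x := Multiplicative.ofAdd x.m
  map_one' := rfl
  map_mul' _ _ := rfl

/-- For odd `n`, the commutator of `H` is `ω`. -/
theorem commutator_eq (hn : Odd n) (x y : Heis D) :
    x * y = incl D (D.form x.m y.m) * (y * x) := by
  ext1
  · simp [incl, add_comm]
  · simp only [incl, MonoidHom.coe_mk, OneHom.coe_mk, mul_a, halfForm_zero_left, mul_one,
      ← D.halfForm_sq hn x.m y.m, D.halfForm_swap x.m y.m]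
    rw [pow_two, mul_comm y.a x.a, mul_comm (x.a * y.a) (D.halfForm x.m y.m)⁻¹, ← mul_assoc,
      mul_inv_cancel_right, mul_comm]

/-- The symmetric structure `σ(m, a) = (-m, a)` of `H`. -/
def sigma (D : SymplecticModule.{u} e n) : Heis D ≃* Heis D where
  toFun x := ⟨-x.m, x.a⟩
  invFun x := ⟨-x.m, x.a⟩
  left_inv x := by simp
  right_inv x := by simp
  map_mul' x y := by
    ext1
    · simp [add_comm]
    · have h := D.halfForm_swap (-y.m) x.m
      simp [halfForm_neg_left, h]
      exact D.halfForm_swap _ _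

end Heis

/-- Symplectic isomorphisms `(M, ω) ≃ (M', ω')`. -/
@[ext] structure Iso (D D' : SymplecticModule.{u} e n) where
  /-- the isomorphism of abelian groups -/
  toEquiv : D.M ≃+ D'.M
  form_map : ∀ x y, D'.form (toEquiv x) (toEquiv y) = D.form x y

namespace Iso

variable {D D' D'' : SymplecticModule.{u} e n}

/-- The identity. -/
def refl (D : SymplecticModule.{u} e n) : Iso D D := ⟨AddEquiv.refl D.M, fun _ _ => rfl⟩

/-- The composite `g ∘ f`. -/
def comp (g : Iso D' D'') (f : Iso D D') : Iso D D'' :=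
  ⟨f.toEquiv.trans g.toEquiv, fun x y => by simp [g.form_map, f.form_map]⟩

/-- The inverse. -/
def symm (f : Iso D D') : Iso D' D :=
  ⟨f.toEquiv.symm, fun x y => by rw [← f.form_map]; simp⟩

/-- The isomorphism `H(M) ≃ H(M')`, `(m, a) ↦ (f m, a)`, induced by `f : M ≃ M'`. -/
def heis (f : Iso D D') : Heis D ≃* Heis D' where
  toFun x := ⟨f.toEquiv x.m, x.a⟩
  invFun x := ⟨f.toEquiv.symm x.m, x.a⟩
  left_inv x := by simp
  right_inv x := by simp
  map_mul' x y := by ext1 <;> simp [halfForm, f.form_map]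

end Iso

/-- The symplectic group `Sp(M)`. -/
abbrev Sp (D : SymplecticModule.{u} e n) := Iso D D

instance (D : SymplecticModule.{u} e n) : Group (Sp D) where
  mul g f := g.comp f
  one := Iso.refl D
  inv f := f.symm
  mul_assoc _ _ _ := rfl
  one_mul _ := rfl
  mul_one _ := rfl
  inv_mul_cancel f := Iso.ext (AddEquiv.ext fun x => f.toEquiv.symm_apply_apply x)

/-- The action of `Sp(M)` on `H` by `g (m, a) = (g m, a)`. -/
def spAction (D : SymplecticModule.{u} e n) : Sp D →* MulAut (Heis D) where
  toFun g := g.heis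
  map_one' := rfl
  map_mul' _ _ := rfl

/-- Lagrangian subgroups: `L = L^⊥`. -/
@[ext] structure Lagrangian (D : SymplecticModule.{u} e n) where
  /-- the underlying subgroup -/
  L : AddSubgroup D.M
  mem_iff : ∀ x, x ∈ L ↔ ∀ y ∈ L, D.form x y = 1

/-- The image of a Lagrangian subgroup under a symplectic isomorphism. -/
def Lagrangian.map {D D' : SymplecticModule.{u} e n} (f : Iso D D') (L : Lagrangian D) :
    Lagrangian D' where
  L := L.L.map f.toEquiv.toAddMonoidHom
  mem_iff x := by
    obtain ⟨x, rfl⟩ := f.toEquiv.surjective x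
    have h : f.toEquiv x ∈ L.L.map f.toEquiv.toAddMonoidHom ↔ x ∈ L.L :=
      AddSubgroup.mem_map_iff_mem f.toEquiv.injective
    rw [h, L.mem_iff]
    constructor
    · rintro hx _ ⟨y, hy, rfl⟩
      exact (f.form_map x y).trans (hx y hy)
    · intro hx y hy
      rw [← f.form_map]
      exact hx _ ⟨y, hy, rfl⟩

variable [CharZero e]

/-- The space `ℋ_L` (over `K`) of functions `f : H → K` such that `f((l, a) h) = a f(h)` for `l ∈ L`,
`a ∈ μ_n`, `h ∈ H`; the group `H` acts on it by right translations. -/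
def Lagrangian.model {D : SymplecticModule.{u} e n} (L : Lagrangian D) :
    Submodule (coeffField e n) (Heis D → coeffField e n) where
  carrier := {f | ∀ l ∈ L.L, ∀ (a : rootsOfUnity n e) (h : Heis D),
    f (⟨l, a⟩ * h) = tautChar e n a * f h}
  add_mem' hf hg l hl a h := by simp [hf l hl a h, hg l hl a h, mul_add]
  zero_mem' := by simp
  smul_mem' c f hf l hl a h := by simp [hf l hl a h, mul_left_comm]

/-- A representation of `H` over `K` (with its underlying vector space). -/
structure HeisRep (D : SymplecticModule.{u} e n) where
  /-- the underlying vector space -/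
  V : Type v
  [addCommGroup : AddCommGroup V]
  [module : Module (coeffField e n) V]
  /-- the action of `H` -/
  ρ : Representation (coeffField e n) (Heis D) V

attribute [instance] HeisRep.addCommGroup HeisRep.module

end SymplecticModule

end FiniteHeisenberg

/-! Intertwiners between two models `ℋ_L` are unique up to a scalar, and the task is to choose the
scalars compatibly with composition. The extra structure that does this is the symmetry `σ(m, a) =
(-m, a)`. It splits `ℋ_L` into even and odd functions, and since `M / L` has odd order `2k + 1`,
their dimensions are `k + 1` and `k`. Multiplying an even map by `c` therefore multiplies its
Berezinian `det₊ / det₋` by `c ^ (k + 1) / c ^ k = c`. Once each `ℋ_L` has a volume element, each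
scalar is fixed by requiring Berezinian `1`; no root has to be extracted, and multiplicativity of
the Berezinian makes the normalized intertwiners compose strictly.

Volume elements come from a `Frame`: representatives of the nonzero classes of `M / L` modulo sign,
giving the coordinates `φ(r) + φ(-r)` and `φ(r) - φ(-r)`. Replacing one frame by another permutes
and rescales even and odd coordinates in the same way, apart from signs on the odd ones. The
Berezinian thus changes only by a sign, which is the sign in (ii): see `superDet_pullback` and
`exists_transport_map_apply`.

Existence of intertwiners comes from averaging over a Lagrangian subgroup, which commutes with `σ`.
Irreducibility and uniqueness both rest on the vacuum vector `delta 0`: it is cyclic, and averaging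
over `L` projects onto its line. -/

namespace FiniteHeisenberg

/-! ### Berezinians on superspaces of dimension `(k + 1 | k)` -/

section SuperDet

variable {K : Type*} [Field K] {k k' k'' : ℕ}

/-- The coordinate superspace of dimension `(k + 1 | k)`. -/
abbrev SuperSpace (K : Type*) (k : ℕ) := (Option (Fin k) → K) × (Fin k → K)

/-- The parity involution. -/
def parity (x : SuperSpace K k) : SuperSpace K k := (x.1, -x.2)

/-- The block of a linear map between the even parts. -/
def evenBlock (Φ : SuperSpace K k →ₗ[K] SuperSpace K k') :
    (Option (Fin k) → K) →ₗ[K] (Option (Fin k') → K) :=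
  LinearMap.fst K _ _ ∘ₗ Φ ∘ₗ LinearMap.inl K _ _

/-- The block of a linear map between the odd parts. -/
def oddBlock (Φ : SuperSpace K k →ₗ[K] SuperSpace K k') : (Fin k → K) →ₗ[K] (Fin k' → K) :=
  LinearMap.snd K _ _ ∘ₗ Φ ∘ₗ LinearMap.inr K _ _

/-- The Berezinian `det Φ₊ / det Φ₋` of a parity-preserving map between superspaces of the same
dimension. -/
noncomputable def superDet (Φ : SuperSpace K k →ₗ[K] SuperSpace K k') : K :=
  -- Sizes of frames of different Lagrangian subgroups agree only propositionally. The default `0`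
  -- never occurs between isomorphic models, by `Frame.k_eq`.
  if h : k = k' then
    LinearMap.det (evenBlock (h.symm ▸ Φ : SuperSpace K k →ₗ[K] SuperSpace K k)) /
      LinearMap.det (oddBlock (h.symm ▸ Φ : SuperSpace K k →ₗ[K] SuperSpace K k))
  else 0

theorem superDet_self (Φ : SuperSpace K k →ₗ[K] SuperSpace K k) :
    superDet Φ = LinearMap.det (evenBlock Φ) / LinearMap.det (oddBlock Φ) := by
  simp [superDet]

/-- A linear map is even if it commutes with the parity involutions. -/
def IsEven (Φ : SuperSpace K k →ₗ[K] SuperSpace K k') : Prop :=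
  ∀ x, Φ (parity x) = parity (Φ x)

/-- The single extra even dimension makes the Berezinian homogeneous of degree one; this is what
pins down scalars uniquely. -/
theorem superDet_of_apply_eq_smul (h : k = k') {c : K} (hc : c ≠ 0)
    {Φ Ψ : SuperSpace K k →ₗ[K] SuperSpace K k'} (hΨ : ∀ x, Ψ x = c • Φ x) :
    superDet Ψ = c * superDet Φ := by
  subst h
  have h1 : evenBlock Ψ = c • evenBlock Φ :=
    LinearMap.ext fun x => congrArg Prod.fst (hΨ (x, 0))
  have h2 : oddBlock Ψ = c • oddBlock Φ :=
    LinearMap.ext fun x => congrArg Prod.snd (hΨ (0, x))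
  rw [superDet_self, superDet_self, h1, h2, LinearMap.det_smul, LinearMap.det_smul]
  simp only [Module.finrank_fintype_fun_eq_card, Fintype.card_option, pow_succ']
  rw [mul_assoc, mul_div_assoc, mul_div_mul_left _ _ (pow_ne_zero _ hc)]

theorem superDet_id : superDet (LinearMap.id : SuperSpace K k →ₗ[K] SuperSpace K k) = 1 := by
  have h1 : evenBlock (LinearMap.id : SuperSpace K k →ₗ[K] SuperSpace K k) = LinearMap.id := rfl
  have h2 : oddBlock (LinearMap.id : SuperSpace K k →ₗ[K] SuperSpace K k) = LinearMap.id := rfl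
  rw [superDet_self, h1, h2, LinearMap.det_id, LinearMap.det_id, div_one]

theorem det_eq_of_apply_eq_mul_perm {ι : Type*} [Fintype ι] [DecidableEq ι] (σ : Equiv.Perm ι)
    (b : ι → K) (A : (ι → K) →ₗ[K] (ι → K)) (hA : ∀ p i, A p i = b i * p (σ i)) :
    LinearMap.det A = (∏ i, b i) * (Equiv.Perm.sign σ : ℤ) := by
  have h : A = Matrix.toLin' (Matrix.diagonal b * σ.permMatrix K) := by
    refine LinearMap.ext fun p => funext fun i => ?_
    rw [hA, Matrix.toLin'_apply, ← Matrix.mulVec_mulVec, Matrix.mulVec_diagonal,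
      Matrix.permMatrix_mulVec, Function.comp_apply]
  rw [h, LinearMap.det_toLin', Matrix.det_mul, Matrix.det_diagonal, Matrix.det_permutation]

variable [CharZero K]

theorem IsEven.apply_inl {Φ : SuperSpace K k →ₗ[K] SuperSpace K k'} (hΦ : IsEven Φ)
    (p : Option (Fin k) → K) : Φ (p, 0) = (evenBlock Φ p, 0) := by
  refine Prod.ext rfl (funext fun i => ?_)
  have h := congrFun (congrArg Prod.snd (hΦ (p, 0))) i
  simp only [parity, neg_zero, Pi.neg_apply] at h
  exact self_eq_neg.1 h

theorem IsEven.apply_inr {Φ : SuperSpace K k →ₗ[K] SuperSpace K k'} (hΦ : IsEven Φ)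
    (q : Fin k → K) : Φ (0, q) = (0, oddBlock Φ q) := by
  refine Prod.ext (funext fun i => ?_) rfl
  have h := congrFun (congrArg Prod.fst (hΦ (0, q))) i
  have h2 : parity ((0, q) : SuperSpace K k) = -(0, q) := by simp [parity]
  rw [h2, map_neg] at h
  simp only [parity, Prod.fst_neg, Pi.neg_apply] at h
  exact self_eq_neg.1 h.symm

/-- An even `Φ` has no off-diagonal blocks, so the diagonal blocks of the composite are composites
of the diagonal blocks. -/
theorem superDet_comp (h : k = k') (h' : k' = k'') {Ψ : SuperSpace K k' →ₗ[K] SuperSpace K k''}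
    {Φ : SuperSpace K k →ₗ[K] SuperSpace K k'} (hΦ : IsEven Φ) :
    superDet (Ψ ∘ₗ Φ) = superDet Ψ * superDet Φ := by
  subst h h'
  have h1 : evenBlock (Ψ ∘ₗ Φ) = evenBlock Ψ ∘ₗ evenBlock Φ := by
    refine LinearMap.ext fun p => ?_
    change (Ψ (Φ (p, 0))).1 = (Ψ (evenBlock Φ p, 0)).1
    rw [hΦ.apply_inl]
  have h2 : oddBlock (Ψ ∘ₗ Φ) = oddBlock Ψ ∘ₗ oddBlock Φ := by
    refine LinearMap.ext fun p => ?_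
    change (Ψ (Φ (0, p))).2 = (Ψ (0, oddBlock Φ p)).2
    rw [hΦ.apply_inr]
  rw [superDet_self, superDet_self, superDet_self, h1, h2, LinearMap.det_comp, LinearMap.det_comp,
    mul_div_mul_comm]

theorem superDet_ne_zero (h : k = k') (Φ : SuperSpace K k ≃ₗ[K] SuperSpace K k')
    (hΦ : IsEven Φ.toLinearMap) : superDet Φ.toLinearMap ≠ 0 := by
  intro h0
  have h1 := superDet_comp h h.symm (Ψ := Φ.symm.toLinearMap) hΦ
  have h2 : Φ.symm.toLinearMap ∘ₗ Φ.toLinearMap = LinearMap.id :=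
    LinearMap.ext fun x => by simp
  rw [h2, superDet_id, h0, mul_zero] at h1
  exact one_ne_zero h1

/-- A monomial map whose even and odd entries differ by signs only has superdeterminant `±1`. -/
theorem superDet_monomial (h : k = k') (Φ : SuperSpace K k →ₗ[K] SuperSpace K k')
    (τ : Fin k' → Fin k) (hτ : Function.Injective τ) (b : Fin k' → K) (hb : ∀ i, b i ≠ 0)
    (s : Fin k' → ℤˣ) (hnone : ∀ x, (Φ x).1 none = x.1 none)
    (hsome : ∀ x i, (Φ x).1 (some i) = b i * x.1 (some (τ i)))
    (hodd : ∀ x i, (Φ x).2 i = ((s i : ℤ) : K) * b i * x.2 (τ i)) :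
    superDet Φ = (((∏ i, s i : ℤˣ) : ℤ) : K) := by
  subst h
  let σ : Equiv.Perm (Fin k) := Equiv.ofBijective τ (Finite.injective_iff_bijective.1 hτ)
  have h1 := det_eq_of_apply_eq_mul_perm (Equiv.optionCongr σ) (fun i => i.elim 1 b) (evenBlock Φ)
    (fun p i => by
      cases i with
      | none => simpa [evenBlock] using hnone (p, 0)
      | some i => simpa [evenBlock, σ] using hsome (p, 0) i)
  have h2 := det_eq_of_apply_eq_mul_perm σ (fun i => ((s i : ℤ) : K) * b i) (oddBlock Φ)
    (fun p i => by simpa [oddBlock, σ] using hodd (0, p) i)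
  have h3 : (∏ i, b i) * ((Equiv.Perm.sign σ : ℤ) : K) ≠ 0 := by
    refine mul_ne_zero (Finset.prod_ne_zero_iff.2 fun i _ => hb i) ?_
    exact_mod_cast (Equiv.Perm.sign σ).ne_zero
  -- Adding the fixed point `none` leaves the sign of `σ` unchanged, so `(∏ b) * sign σ` cancels and
  -- `∏ s⁻¹ = ∏ s` remains.
  rw [superDet_self, h1, h2, Equiv.optionCongr_sign, Fintype.prod_option, Finset.prod_mul_distrib]
  simp only [Option.elim, one_mul]
  rw [mul_assoc, div_mul_cancel_right₀ h3]
  push_cast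
  rw [← Finset.prod_inv_distrib]
  refine Finset.prod_congr rfl fun i _ => ?_
  rcases Int.units_eq_one_or (s i) with h | h <;> simp [h]

end SuperDet

end FiniteHeisenberg

/-! ### Lagrangian models: irreducibility, Schur's lemma, averaging intertwiners -/

namespace FiniteHeisenberg

namespace SymplecticModule

variable {e : Type v} [Field e] {n : ℕ} {D D' D'' : SymplecticModule.{u} e n}

/-- A maximal isotropic subgroup is Lagrangian. -/
theorem exists_lagrangian (D : SymplecticModule.{u} e n) : Nonempty (Lagrangian D) := by
  have hswap : ∀ x y, D.form x y = 1 → D.form y x = 1 := fun x y h => by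
    have h1 := D.form_self (x + y)
    rw [form_add_left, form_add_right, form_add_right, form_self, form_self, h, one_mul, one_mul,
      mul_one] at h1
    exact h1
  have hz : ∀ x, D.form x 0 = 1 := fun x => by
    have h := D.form_add_right x 0 0
    rw [add_zero] at h
    exact left_eq_mul.1 h
  have hneg : ∀ x y, D.form x y = 1 → D.form x (-y) = 1 := fun x y h => by
    have h1 := D.form_add_right x y (-y)
    rwa [add_neg_cancel, hz, h, one_mul, eq_comm] at h1
  let S : Set (AddSubgroup D.M) := {L | ∀ x ∈ L, ∀ y ∈ L, D.form x y = 1}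
  have hS : S.Nonempty := ⟨⊥, fun x _ y hy => by rw [AddSubgroup.mem_bot.1 hy, hz]⟩
  obtain ⟨L, hL⟩ := (Set.toFinite S).exists_maximal hS
  refine ⟨⟨L, fun x => ⟨fun hx y hy => hL.prop x hx y hy, fun hx => ?_⟩⟩⟩
  -- Isotropy of the closure is checked one variable at a time: `P` is the orthogonal of the
  -- generators, and `Q` below that of a fixed element of the closure.
  let P : AddSubgroup D.M :=
    { carrier := {y | ∀ z ∈ insert x (L : Set D.M), D.form z y = 1}
      zero_mem' := fun z _ => hz z
      add_mem' := fun ha hb z h => by rw [form_add_right, ha z h, hb z h, one_mul]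
      neg_mem' := fun ha z h => hneg _ _ (ha z h) }
  have hP : AddSubgroup.closure (insert x (L : Set D.M)) ≤ P := by
    rw [AddSubgroup.closure_le]
    rintro y (rfl | hy) z (rfl | hz')
    · exact D.form_self _
    · exact hswap _ _ (hx z hz')
    · exact hx y hy
    · exact hL.prop z hz' y hy
  have hQ : AddSubgroup.closure (insert x (L : Set D.M)) ∈ S := by
    intro a ha b hb
    let Q : AddSubgroup D.M :=
      { carrier := {y | D.form b y = 1}
        zero_mem' := hz b
        add_mem' := fun {a c} ha hb => by
          change D.form b (a + c) = 1
          rw [form_add_right, show D.form b a = 1 from ha, show D.form b c = 1 from hb, one_mul]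
        neg_mem' := fun ha => hneg _ _ ha }
    have : AddSubgroup.closure (insert x (L : Set D.M)) ≤ Q := by
      rw [AddSubgroup.closure_le]
      exact fun z hz' => hswap _ _ (hP hb z hz')
    exact hswap _ _ (this ha)
  have hle : L ≤ AddSubgroup.closure (insert x (L : Set D.M)) := fun y hy =>
    AddSubgroup.subset_closure (Set.mem_insert_of_mem _ hy)
  exact hL.le_of_ge hQ hle (AddSubgroup.subset_closure (Set.mem_insert _ _))

theorem halfForm_neg_right (D : SymplecticModule.{u} e n) (x y : D.M) :
    D.halfForm x (-y) = (D.halfForm x y)⁻¹ := by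
  rw [D.halfForm_swap, D.halfForm_neg_left, ← D.halfForm_swap y x]

theorem symm_heis_heis (f : Iso D D') (h : Heis D) : f.symm.heis (f.heis h) = h :=
  f.heis.symm_apply_apply h

theorem sigma_heis (f : Iso D D') (h : Heis D) :
    Heis.sigma D' (f.heis h) = f.heis (Heis.sigma D h) := by
  ext1 <;> simp [Heis.sigma, Iso.heis]

namespace Lagrangian

theorem halfForm_eq_one (L : Lagrangian D) {x y : D.M} (hx : x ∈ L.L) (hy : y ∈ L.L) :
    D.halfForm x y = 1 := by
  rw [halfForm, (L.mem_iff x).1 hx y hy, one_pow]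

variable [CharZero e]

theorem tautChar_ne_zero (a : rootsOfUnity n e) : tautChar e n a ≠ 0 := by
  intro h
  have h1 : tautChar e n (a * a⁻¹) = 0 := by rw [map_mul, h, zero_mul]
  rw [mul_inv_cancel, map_one] at h1
  exact one_ne_zero h1

theorem tautChar_injective : Function.Injective (tautChar e n) := fun a b h => by
  have h1 : ((a : eˣ) : e) = ((b : eˣ) : e) := congrArg Subtype.val h
  exact Subtype.ext (Units.ext h1)

/-- Right translations on `ℋ_L`. -/
noncomputable def rep (L : Lagrangian D) : Representation (coeffField e n) (Heis D) L.model where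
  toFun h :=
    { toFun f := ⟨fun x => f.1 (x * h), fun l hl a x => by
        change f.1 (_ * x * h) = _
        rw [mul_assoc]
        exact f.2 l hl a (x * h)⟩
      map_add' _ _ := rfl
      map_smul' _ _ := rfl }
  map_one' := LinearMap.ext fun f => Subtype.ext (funext fun x => congrArg f.1 (mul_one x))
  map_mul' h h' := LinearMap.ext fun f => Subtype.ext (funext fun x =>
    congrArg f.1 (mul_assoc x h h').symm)

@[simp] theorem rep_apply (L : Lagrangian D) (h x : Heis D) (f : L.model) :
    (L.rep h f).1 x = f.1 (x * h) := rfl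

/-- The action of the symmetric structure `σ` on `ℋ_L`. -/
noncomputable def flip (L : Lagrangian D) : L.model →ₗ[coeffField e n] L.model where
  toFun f := ⟨fun x => f.1 (Heis.sigma D x), fun l hl a x => by
    change f.1 (Heis.sigma D (_ * x)) = _
    rw [map_mul]
    exact f.2 (-l) (neg_mem hl) a _⟩
  map_add' _ _ := rfl
  map_smul' _ _ := rfl

@[simp] theorem flip_apply (L : Lagrangian D) (x : Heis D) (f : L.model) :
    (L.flip f).1 x = f.1 (Heis.sigma D x) := rfl

theorem model_apply (L : Lagrangian D) (f : L.model) (x : Heis D) :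
    f.1 x = tautChar e n x.a * f.1 ⟨x.m, 1⟩ := by
  have h : x = ⟨0, x.a⟩ * ⟨x.m, 1⟩ := by ext1 <;> simp [halfForm_zero_left]
  exact (congrArg f.1 h).trans (f.2 0 (zero_mem _) _ _)

theorem model_apply_of_sub_mem (L : Lagrangian D) (f : L.model) {x m : D.M} (h : x - m ∈ L.L) :
    f.1 ⟨x, 1⟩ = tautChar e n (D.halfForm x m)⁻¹ * f.1 ⟨m, 1⟩ := by
  have h1 := D.halfForm_add_left (x - m) m m
  rw [sub_add_cancel, D.halfForm_self, mul_one] at h1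
  have h2 : (⟨x, 1⟩ : Heis D) = ⟨x - m, (D.halfForm x m)⁻¹⟩ * ⟨m, 1⟩ := by
    ext1 <;> simp [h1]
  exact (congrArg f.1 h2).trans (f.2 _ h _ _)

open Classical in
/-- The function in `ℋ_L` supported on the coset `L + m` with value `1` at `(m, 1)`. -/
noncomputable def delta (L : Lagrangian D) (m : D.M) : L.model :=
  ⟨fun x => if x.m - m ∈ L.L then tautChar e n (x.a * (D.halfForm x.m m)⁻¹) else 0, by
    intro l hl a x
    have h1 : l + x.m - m ∈ L.L ↔ x.m - m ∈ L.L := by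
      rw [add_sub_assoc, L.L.add_mem_cancel_left hl]
    simp only [Heis.mul_m, Heis.mul_a, h1]
    split_ifs with h
    · have h2 : D.halfForm l x.m = D.halfForm l m := by
        have h3 := D.halfForm_add_right l (x.m - m) m
        rwa [sub_add_cancel, L.halfForm_eq_one hl h, one_mul] at h3
      rw [D.halfForm_add_left, h2, ← map_mul]
      congr 1
      rw [mul_inv, ← mul_assoc, mul_assoc (a * x.a), mul_comm (D.halfForm l m),
        mul_assoc, mul_assoc]
      simp
    · rw [mul_zero]⟩

open Classical in
theorem delta_apply (L : Lagrangian D) (m : D.M) (x : Heis D) : (L.delta m).1 x =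
    if x.m - m ∈ L.L then tautChar e n (x.a * (D.halfForm x.m m)⁻¹) else 0 := rfl

theorem delta_apply_self (L : Lagrangian D) (m : D.M) : (L.delta m).1 ⟨m, 1⟩ = 1 := by
  simp [delta_apply, halfForm_self]

theorem delta_apply_of_not_mem (L : Lagrangian D) {m x : D.M} (h : x - m ∉ L.L) :
    (L.delta m).1 ⟨x, 1⟩ = 0 := by
  simp [delta_apply, h]

theorem rep_delta_zero (L : Lagrangian D) (m : D.M) : L.rep ⟨-m, 1⟩ (L.delta 0) = L.delta m := by
  refine Subtype.ext (funext fun x => ?_)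
  simp only [rep_apply, delta_apply, Heis.mul_m, Heis.mul_a, halfForm_zero_right,
    halfForm_neg_right, inv_one, mul_one]
  classical exact if_congr (by rw [sub_zero, sub_eq_add_neg]) rfl rfl

theorem model_ext (L : Lagrangian D) {f g : L.model} (h : ∀ m, f.1 ⟨m, 1⟩ = g.1 ⟨m, 1⟩) :
    f = g :=
  Subtype.ext (funext fun x => by rw [L.model_apply f, L.model_apply g, h])

theorem sum_indicator (L : Lagrangian D) [Fintype D.M] [DecidablePred (· ∈ L.L)] [Fintype L.L]
    (c : coeffField e n) : ∑ u : D.M, (if u ∈ L.L then c else 0) = Fintype.card L.L * c := by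
  rw [← Finset.sum_filter, Finset.sum_const, nsmul_eq_mul, Fintype.card_subtype]

/-- Every element of `ℋ_L` is a combination of translates of the vacuum vector. -/
theorem card_smul_eq_sum (L : Lagrangian D) [Fintype D.M] [Fintype L.L] (f : L.model) :
    (Fintype.card L.L : coeffField e n) • f =
      ∑ m : D.M, f.1 ⟨m, 1⟩ • L.rep ⟨-m, 1⟩ (L.delta 0) := by
  classical
  refine L.model_ext fun x => ?_
  -- The term of `m` contributes `f(x)` exactly when `m ∈ x + L`, whence the factor `|L|`.
  have h : ∀ m : D.M, f.1 ⟨m, 1⟩ * (L.delta m).1 ⟨x, 1⟩ =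
      if x - m ∈ L.L then f.1 ⟨x, 1⟩ else 0 := fun m => by
    rw [delta_apply]
    split_ifs with hm
    · rw [L.model_apply_of_sub_mem f hm, one_mul, mul_comm]
    · rw [mul_zero]
  have h2 : (∑ m : D.M, f.1 ⟨m, 1⟩ • L.rep ⟨-m, 1⟩ (L.delta 0)).1 ⟨x, 1⟩ =
      ∑ m : D.M, f.1 ⟨m, 1⟩ * (L.delta m).1 ⟨x, 1⟩ := by
    simp only [rep_delta_zero]
    rw [Submodule.coe_sum, Finset.sum_apply]
    rfl
  rw [h2, Finset.sum_congr rfl fun m _ => h m]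
  exact ((Fintype.sum_equiv (Equiv.subLeft x) _ _ fun m => rfl).trans
    (L.sum_indicator (f.1 ⟨x, 1⟩))).symm

/-- Orthogonality of characters: `l ↦ ω(x, l)` is trivial on `L` exactly when `x ∈ L^⊥ = L`. -/
theorem sum_form_eq (L : Lagrangian D) [Fintype L.L] (x : D.M) [Decidable (x ∈ L.L)] :
    ∑ l : L.L, tautChar e n (D.form x l) = if x ∈ L.L then (Fintype.card L.L : coeffField e n)
      else 0 := by
  split_ifs with hx
  · rw [Finset.sum_congr rfl fun l _ => by rw [(L.mem_iff x).1 hx l l.2, map_one]]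
    simp
  · rw [L.mem_iff x] at hx
    push Not at hx
    obtain ⟨y, hy, hxy⟩ := hx
    have h1 : ∑ l : L.L, tautChar e n (D.form x l) =
        tautChar e n (D.form x y) * ∑ l : L.L, tautChar e n (D.form x l) := by
      rw [Finset.mul_sum]
      refine (Fintype.sum_equiv (Equiv.addLeft (⟨y, hy⟩ : L.L)) _ _ fun l => ?_).symm
      rw [← map_mul, ← D.form_add_right]
      rfl
    by_contra h0
    exact hxy (tautChar_injective ((right_eq_mul₀ h0).1 h1 |>.trans (map_one _).symm))

/-- Averaging over `L` projects to the line of the vacuum vector. -/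
theorem sum_rep_eq (hn : Odd n) (L : Lagrangian D) [Fintype L.L] (f : L.model) :
    ∑ l : L.L, L.rep ⟨l, 1⟩ f = ((Fintype.card L.L : coeffField e n) * f.1 1) • L.delta 0 := by
  classical
  refine L.model_ext fun x => ?_
  -- Commuting `(l, 1)` to the left, where `f` absorbs it, costs the factor `ω(x, l)`; summed over
  -- `l`, this vanishes off `L`.
  have h : ∀ l : L.L, (L.rep ⟨l, 1⟩ f).1 ⟨x, 1⟩ = tautChar e n (D.form x l) * f.1 ⟨x, 1⟩ := by
    intro l
    rw [rep_apply, Heis.commutator_eq hn, Heis.incl]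
    change f.1 (⟨0, D.form x l⟩ * _) = _
    rw [f.2 0 (zero_mem _), f.2 l l.2, map_one, one_mul]
  rw [Submodule.coe_sum, Finset.sum_apply, Finset.sum_congr rfl fun l _ => h l, ← Finset.sum_mul,
    sum_form_eq]
  change _ = (Fintype.card L.L : coeffField e n) * f.1 1 * (L.delta 0).1 ⟨x, 1⟩
  rw [delta_apply]
  simp only [sub_zero, halfForm_zero_right, inv_one, mul_one, map_one]
  split_ifs with hx
  · have h0 : x - 0 ∈ L.L := by rwa [sub_zero]
    rw [L.model_apply_of_sub_mem f h0, halfForm_zero_right, inv_one, map_one, one_mul, mul_one]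
    rfl
  · simp

theorem card_ne_zero (L : Lagrangian D) [Fintype L.L] :
    (Fintype.card L.L : coeffField e n) ≠ 0 :=
  Nat.cast_ne_zero.2 Fintype.card_ne_zero

/-- The vacuum vector is cyclic: its translates span `ℋ_L`. -/
theorem eq_top_of_delta_mem (L : Lagrangian D) (U : Submodule (coeffField e n) L.model)
    (hU : ∀ h, ∀ v ∈ U, L.rep h v ∈ U) (h0 : L.delta 0 ∈ U) : U = ⊤ := by
  classical
  have := Fintype.ofFinite D.M
  have := Fintype.ofFinite L.L
  refine Submodule.eq_top_iff'.2 fun f => ?_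
  rw [← U.smul_mem_iff L.card_ne_zero, card_smul_eq_sum]
  exact U.sum_mem fun m _ => U.smul_mem _ (hU _ _ h0)

/-- Translate a nonzero function to be nonzero at `1`; its average over `L` is then a nonzero
multiple of the cyclic vacuum vector. -/
theorem eq_bot_or_eq_top (hn : Odd n) (L : Lagrangian D)
    (U : Submodule (coeffField e n) L.model) (hU : ∀ h, ∀ v ∈ U, L.rep h v ∈ U) :
    U = ⊥ ∨ U = ⊤ := by
  have := Fintype.ofFinite L.L
  refine or_iff_not_imp_left.2 fun hb => ?_
  obtain ⟨f, hf, hf0⟩ := (Submodule.ne_bot_iff U).1 hb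
  obtain ⟨m, hm⟩ : ∃ m : D.M, f.1 ⟨m, 1⟩ ≠ 0 := by
    by_contra! h
    exact hf0 (L.model_ext h)
  refine L.eq_top_of_delta_mem U hU ?_
  have h1 : ∑ l : L.L, L.rep ⟨l, 1⟩ (L.rep ⟨m, 1⟩ f) ∈ U :=
    U.sum_mem fun l _ => hU _ _ (hU _ _ hf)
  rw [L.sum_rep_eq hn, rep_apply, one_mul] at h1
  exact (U.smul_mem_iff (mul_ne_zero L.card_ne_zero hm)).1 h1

theorem delta_zero_ne_zero (L : Lagrangian D) : L.delta 0 ≠ 0 := fun h => by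
  have h1 := L.delta_apply_self 0
  rw [h] at h1
  exact zero_ne_one h1

/-- The linear maps `ℋ_L → ℋ_L'` that are equivariant along `H(f)`. -/
def Intertwines (f : Iso D D') {L : Lagrangian D} {L' : Lagrangian D'}
    (A : L.model →ₗ[coeffField e n] L'.model) : Prop :=
  ∀ h v, A (L.rep h v) = L'.rep (f.heis h) (A v)

theorem Intertwines.comp {g : Iso D' D''} {f : Iso D D'} {L : Lagrangian D} {L' : Lagrangian D'}
    {L'' : Lagrangian D''} {B : L'.model →ₗ[coeffField e n] L''.model}
    {A : L.model →ₗ[coeffField e n] L'.model} (hB : Intertwines g B) (hA : Intertwines f A) :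
    Intertwines (g.comp f) (B ∘ₗ A) := fun h v => by
  rw [LinearMap.comp_apply, hA, hB]
  rfl

/-- Schur's lemma without an algebraically closed coefficient field: `A` commutes with averaging
over `L`, so it preserves the vacuum line, and its eigenvalue `c` there propagates because the
vacuum is cyclic. -/
theorem Intertwines.eq_smul_id (hn : Odd n) {L : Lagrangian D}
    {A : L.model →ₗ[coeffField e n] L.model} (hA : Intertwines (Iso.refl D) A) :
    ∃ c : coeffField e n, ∀ v, A v = c • v := by
  have := Fintype.ofFinite L.L
  set c := (A (L.delta 0)).1 1 with hc
  let U : Submodule (coeffField e n) L.model :=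
    { carrier := {v | A v = c • v}
      add_mem' := fun {v w} hv hw => by
        change A (v + w) = c • (v + w)
        rw [map_add, show A v = _ from hv, show A w = _ from hw, smul_add]
      zero_mem' := by
        change A 0 = c • 0
        rw [map_zero, smul_zero]
      smul_mem' := fun d v hv => by
        change A (d • v) = c • d • v
        rw [map_smul, show A v = _ from hv, smul_comm] }
  have hA' : ∀ h v, A (L.rep h v) = L.rep h (A v) := hA
  suffices hU : U = ⊤ from ⟨c, fun v => (hU ▸ Submodule.mem_top : v ∈ U)⟩
  refine L.eq_top_of_delta_mem U (fun h v hv => ?_) ?_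
  · change A (L.rep h v) = c • L.rep h v
    rw [hA', show A v = _ from hv, map_smul]
  · change A (L.delta 0) = c • L.delta 0
    have h1 := congrArg A (L.sum_rep_eq hn (L.delta 0))
    simp only [map_sum, map_smul, hA'] at h1
    rw [L.sum_rep_eq hn, ← hc, mul_smul, mul_smul] at h1
    have h2 := smul_right_injective _ L.card_ne_zero h1
    have h3 : (L.delta 0).1 1 = 1 := L.delta_apply_self 0
    rw [h3, one_smul] at h2
    exact h2.symm

theorem Intertwines.eq_smul (hn : Odd n) {f : Iso D D'} {L : Lagrangian D} {L' : Lagrangian D'}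
    {A : L.model ≃ₗ[coeffField e n] L'.model} {B : L.model →ₗ[coeffField e n] L'.model}
    (hA : Intertwines f A.toLinearMap) (hB : Intertwines f B) :
    ∃ c : coeffField e n, ∀ v, B v = c • A v := by
  obtain ⟨c, hc⟩ := Intertwines.eq_smul_id hn (L := L) (A := A.symm.toLinearMap ∘ₗ B) fun h v => by
    have h1 := hA h (A.symm (B v))
    simp only [LinearMap.comp_apply, LinearEquiv.coe_coe, LinearEquiv.apply_symm_apply] at h1 ⊢
    rw [hB, ← h1, LinearEquiv.symm_apply_apply]
    rfl
  refine ⟨c, fun v => ?_⟩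
  have h1 := hc v
  rw [LinearMap.comp_apply, LinearEquiv.coe_coe, LinearEquiv.symm_apply_eq, map_smul] at h1
  exact h1

/-- As `β` is trivial on `L'`, `(l', 1)(l, a) = (0, a)(l' + l, 1)`; shifting the summation index
gives the left equivariance needed for `average`. -/
theorem sum_symm_heis_mul (f : Iso D D') (L : Lagrangian D) (L' : Lagrangian D') [Fintype L'.L]
    (φ : L.model) {l : D'.M} (hl : l ∈ L'.L) (a : rootsOfUnity n e) (x : Heis D') :
    ∑ l' : L'.L, φ.1 (f.symm.heis (⟨l', 1⟩ * (⟨l, a⟩ * x))) =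
      tautChar e n a * ∑ l' : L'.L, φ.1 (f.symm.heis (⟨l', 1⟩ * x)) := by
  rw [Finset.mul_sum]
  refine Fintype.sum_equiv (Equiv.addRight (⟨l, hl⟩ : L'.L)) _ _ fun l' => ?_
  rw [← φ.2 0 (zero_mem _)]
  refine congrArg φ.1 ?_
  have h : (⟨l', 1⟩ : Heis D') * (⟨l, a⟩ * x) = Heis.incl D' a * (⟨l' + l, 1⟩ * x) := by
    rw [← mul_assoc, ← mul_assoc]
    congr 1
    ext1
    · simp [Heis.incl]
    · simp [Heis.incl, L'.halfForm_eq_one l'.2 hl, halfForm_zero_left]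
  rw [h, map_mul]
  congr 1
  ext1
  · exact map_zero f.symm.toEquiv
  · rfl

/-- The averaging operator `(A φ)(x) = ∑ φ (H(f)⁻¹ ((l, 1) x))`, summed over `l ∈ L'`. -/
noncomputable def average (f : Iso D D') (L : Lagrangian D) (L' : Lagrangian D') [Fintype L'.L] :
    L.model →ₗ[coeffField e n] L'.model where
  toFun φ := ⟨fun x => ∑ l : L'.L, φ.1 (f.symm.heis (⟨l, 1⟩ * x)),
    fun _ hl a x => sum_symm_heis_mul f L L' φ hl a x⟩
  map_add' φ ψ := Subtype.ext (funext fun x => by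
    change ∑ l : L'.L, (φ.1 _ + ψ.1 _) = ∑ l : L'.L, φ.1 _ + ∑ l : L'.L, ψ.1 _
    rw [Finset.sum_add_distrib])
  map_smul' c φ := Subtype.ext (funext fun x => by
    change ∑ l : L'.L, c * φ.1 _ = c * ∑ l : L'.L, φ.1 _
    rw [Finset.mul_sum])

theorem average_apply (f : Iso D D') (L : Lagrangian D) (L' : Lagrangian D') [Fintype L'.L]
    (φ : L.model) (x : Heis D') :
    (average f L L' φ).1 x = ∑ l : L'.L, φ.1 (f.symm.heis (⟨l, 1⟩ * x)) := rfl

theorem average_intertwines (f : Iso D D') (L : Lagrangian D) (L' : Lagrangian D')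
    [Fintype L'.L] : Intertwines f (average f L L') := fun h φ =>
  Subtype.ext (funext fun x => by
    simp only [average_apply, rep_apply, ← mul_assoc, map_mul, symm_heis_heis])

theorem average_flip (f : Iso D D') (L : Lagrangian D) (L' : Lagrangian D') [Fintype L'.L]
    (φ : L.model) : average f L L' (L.flip φ) = L'.flip (average f L L' φ) :=
  Subtype.ext (funext fun x => by
    simp only [average_apply, flip_apply]
    refine Fintype.sum_equiv (Equiv.neg _) _ _ fun l => ?_
    rw [sigma_heis, map_mul]
    rfl)

/-- At `1` the average of the vacuum counts the `l ∈ L'` with `f⁻¹(l) ∈ L`. The count includes `l =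
0`, so it is nonzero in characteristic `0`. -/
theorem average_ne_zero (f : Iso D D') (L : Lagrangian D) (L' : Lagrangian D') [Fintype L'.L] :
    average f L L' (L.delta 0) ≠ 0 := by
  classical
  intro h
  have h1 := congrFun (congrArg Subtype.val h) 1
  have h2 : ∀ l : L'.L, (L.delta 0).1 (f.symm.heis (⟨l, 1⟩ * 1)) =
      if f.symm.toEquiv l ∈ L.L then 1 else 0 := fun l => by
    rw [mul_one, delta_apply]
    simp [Iso.heis, halfForm_zero_right]
  rw [average_apply, Finset.sum_congr rfl fun l _ => h2 l, Finset.sum_boole] at h1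
  refine Nat.cast_ne_zero.2 (Finset.card_ne_zero_of_mem (a := 0) ?_) h1
  simp [zero_mem]

/-- Kernel and range are invariant subspaces of irreducible models, and the map is nonzero. -/
theorem average_bijective (hn : Odd n) (f : Iso D D') (L : Lagrangian D) (L' : Lagrangian D')
    [Fintype L'.L] : Function.Bijective (average f L L') := by
  have hA := average_intertwines f L L'
  constructor
  · rw [← LinearMap.ker_eq_bot]
    refine (L.eq_bot_or_eq_top hn _ fun h v hv => ?_).resolve_right fun h => ?_
    · rw [LinearMap.mem_ker] at hv ⊢
      rw [hA, hv, map_zero]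
    · exact average_ne_zero f L L' (LinearMap.mem_ker.1 (h ▸ Submodule.mem_top))
  · rw [← LinearMap.range_eq_top]
    refine (L'.eq_bot_or_eq_top hn _ ?_).resolve_left fun h => ?_
    · rintro h _ ⟨v, rfl⟩
      obtain ⟨h, rfl⟩ := f.heis.surjective h
      exact ⟨L.rep h v, hA h v⟩
    · exact average_ne_zero f L L' ((Submodule.mem_bot _).1 (h ▸ LinearMap.mem_range_self _ _))

/-- Any two models are isomorphic, compatibly with the symmetric structure. -/
theorem exists_intertwiner (hn : Odd n) (f : Iso D D') (L : Lagrangian D) (L' : Lagrangian D') :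
    ∃ A : L.model ≃ₗ[coeffField e n] L'.model, Intertwines f A.toLinearMap ∧
      ∀ φ, A (L.flip φ) = L'.flip (A φ) := by
  have := Fintype.ofFinite L'.L
  exact ⟨LinearEquiv.ofBijective _ (average_bijective hn f L L'), average_intertwines f L L',
    average_flip f L L'⟩

end Lagrangian

end SymplecticModule

end FiniteHeisenberg

/-! ### Frames and the even and odd coordinates of a model -/

namespace FiniteHeisenberg

namespace SymplecticModule

variable {e : Type v} [Field e] {n : ℕ} {D D' D'' : SymplecticModule.{u} e n}

namespace Lagrangian

/-- Representatives of the nonzero elements of `M / L` up to sign. -/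
structure Frame (L : Lagrangian D) where
  /-- the number of representatives -/
  k : ℕ
  /-- the representatives -/
  R : Fin k → D.M
  sub_mem : ∀ i j, R i - R j ∈ L.L → i = j
  add_not_mem : ∀ i j, R i + R j ∉ L.L
  not_mem : ∀ i, R i ∉ L.L
  exists_mem : ∀ m, m ∉ L.L → ∃ i, m - R i ∈ L.L ∨ m + R i ∈ L.L

theorem mem_map_iff (f : Iso D D') (L : Lagrangian D) (x : D.M) :
    f.toEquiv x ∈ (L.map f).L ↔ x ∈ L.L :=
  AddSubgroup.mem_map_iff_mem (f := f.toEquiv.toAddMonoidHom) f.toEquiv.injective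

/-- Doubling is invertible because `n` is odd. Hence no nonzero class of `M / L` equals its
negative. -/
theorem mem_of_add_self_mem (hn : Odd n) (L : Lagrangian D) {x : D.M} (h : x + x ∈ L.L) :
    x ∈ L.L := by
  obtain ⟨k, hk⟩ := hn
  have h1 : (2 * k + 1) • x = 0 := by
    rw [← D.exponent_eq.trans hk]
    exact AddMonoid.exponent_nsmul_eq_zero x
  have h2 : x = -(k • (x + x)) := by
    rw [eq_neg_iff_add_eq_zero, ← two_nsmul, ← mul_nsmul, ← succ_nsmul', h1]
  rw [h2]
  exact neg_mem (nsmul_mem h k)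

theorem exists_frame (hn : Odd n) (L : Lagrangian D) : Nonempty L.Frame := by
  let r : Setoid {x : D.M // x ∉ L.L} :=
    { r := fun x y => (x : D.M) - y ∈ L.L ∨ (x : D.M) + y ∈ L.L
      iseqv :=
        { refl := fun x => Or.inl (by rw [sub_self]; exact zero_mem _)
          symm := fun {x y} h => h.imp (fun h => by rw [← neg_sub]; exact neg_mem h)
            (fun h => by rwa [add_comm])
          trans := fun {x y z} h h' => by
            rcases h with h | h <;> rcases h' with h' | h'
            · exact Or.inl (by simpa using add_mem h h')
            · exact Or.inr (by simpa [sub_eq_add_neg, add_assoc] using add_mem h h')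
            · exact Or.inr (by convert sub_mem h h' using 1; abel)
            · exact Or.inl (by convert sub_mem h h' using 1; abel) } }
  obtain ⟨k, ⟨E⟩⟩ := Finite.exists_equiv_fin (Quotient r)
  have key : ∀ i j, ((E.symm i).out : D.M) - (E.symm j).out ∈ L.L ∨
      ((E.symm i).out : D.M) + (E.symm j).out ∈ L.L → i = j := fun i j h => by
    refine E.symm.injective ?_
    rw [← Quotient.out_eq (E.symm i), ← Quotient.out_eq (E.symm j)]
    exact Quotient.sound h
  refine ⟨⟨k, fun i => (E.symm i).out, fun i j h => key i j (Or.inl h), fun i j h => ?_,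
    fun i => (E.symm i).out.2, fun m hm => ⟨E (Quotient.mk r ⟨m, hm⟩), ?_⟩⟩⟩
  · have hij := key i j (Or.inr h)
    subst hij
    exact (E.symm i).out.2 (L.mem_of_add_self_mem hn h)
  · rw [E.symm_apply_apply]
    exact Quotient.exact (Quotient.out_eq (Quotient.mk r ⟨m, hm⟩)).symm

namespace Frame

variable {L : Lagrangian D} {L' : Lagrangian D'} {L'' : Lagrangian D''}

/-- The representatives including `0`. -/
def point (F : L.Frame) (i : Option (Fin F.k)) : D.M := i.elim 0 F.R

variable [CharZero e]

/-- The even and odd coordinates of a function in `ℋ_L`. -/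
noncomputable def coordFun (F : L.Frame) : L.model →ₗ[coeffField e n]
    SuperSpace (coeffField e n) F.k where
  toFun φ := (fun i => φ.1 ⟨F.point i, 1⟩ + φ.1 ⟨-F.point i, 1⟩,
    fun i => φ.1 ⟨F.R i, 1⟩ - φ.1 ⟨-F.R i, 1⟩)
  map_add' _ _ := Prod.ext (funext fun _ => add_add_add_comm _ _ _ _)
    (funext fun _ => add_sub_add_comm _ _ _ _)
  map_smul' _ _ := Prod.ext (funext fun _ => (mul_add _ _ _).symm)
    (funext fun _ => (mul_sub _ _ _).symm)

theorem coordFun_fst (F : L.Frame) (φ : L.model) (i) :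
    (F.coordFun φ).1 i = φ.1 ⟨F.point i, 1⟩ + φ.1 ⟨-F.point i, 1⟩ := rfl

theorem coordFun_snd (F : L.Frame) (φ : L.model) (i) :
    (F.coordFun φ).2 i = φ.1 ⟨F.R i, 1⟩ - φ.1 ⟨-F.R i, 1⟩ := rfl

theorem coordFun_injective (F : L.Frame) : Function.Injective F.coordFun := by
  rw [← LinearMap.ker_eq_bot, LinearMap.ker_eq_bot']
  intro φ h
  have h2 : (2 : coeffField e n) ≠ 0 := two_ne_zero
  have h0 : φ.1 ⟨0, 1⟩ = 0 := by
    have h1 := congrFun (congrArg Prod.fst h) none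
    rw [coordFun_fst] at h1
    simpa [point, ← two_mul] using h1
  have hs : ∀ i, φ.1 ⟨F.R i, 1⟩ + φ.1 ⟨-F.R i, 1⟩ = 0 := fun i =>
    congrFun (congrArg Prod.fst h) (some i)
  have hd : ∀ i, φ.1 ⟨F.R i, 1⟩ - φ.1 ⟨-F.R i, 1⟩ = 0 := fun i =>
    congrFun (congrArg Prod.snd h) i
  have hp : ∀ i, φ.1 ⟨F.R i, 1⟩ = 0 := fun i => by
    refine (mul_eq_zero.1 ?_).resolve_left h2
    linear_combination hs i + hd i
  have hm : ∀ i, φ.1 ⟨-F.R i, 1⟩ = 0 := fun i => by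
    refine (mul_eq_zero.1 ?_).resolve_left h2
    linear_combination hs i - hd i
  refine L.model_ext fun m => ?_
  change φ.1 ⟨m, 1⟩ = 0
  by_cases hmL : m ∈ L.L
  · rw [L.model_apply_of_sub_mem φ (m := 0) (by rwa [sub_zero]), h0, mul_zero]
  · obtain ⟨i, hi | hi⟩ := F.exists_mem m hmL
    · rw [L.model_apply_of_sub_mem φ hi, hp, mul_zero]
    · rw [L.model_apply_of_sub_mem φ (m := -F.R i) (by rwa [sub_neg_eq_add]), hm, mul_zero]

/-- The functions `delta 0` and `delta r ± delta (-r)` map to twice the standard basis vectors, and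
`2` is invertible. -/
theorem coordFun_surjective (F : L.Frame) : Function.Surjective F.coordFun := by
  classical
  rw [← LinearMap.range_eq_top]
  have h2 : (2 : coeffField e n) ≠ 0 := two_ne_zero
  -- The coordinate at `none` is `φ(0) + φ(-0)`, hence the entry `2`.
  have hz : F.coordFun (L.delta 0) = (Pi.single none 2, 0) := by
    refine Prod.ext (funext fun i => ?_) (funext fun i => ?_)
    · rw [coordFun_fst]
      cases i with
      | none =>
        simp only [point, Option.elim, neg_zero, delta_apply_self, Pi.single_eq_same]
        norm_num
      | some i =>
        rw [delta_apply_of_not_mem _ (by simpa [point] using F.not_mem i),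
          delta_apply_of_not_mem _ (by simpa [point] using F.not_mem i)]
        simp
    · rw [coordFun_snd, delta_apply_of_not_mem _ (by simpa using F.not_mem i),
        delta_apply_of_not_mem _ (by simpa using F.not_mem i)]
      simp
  have hp : ∀ i, F.coordFun (L.delta (F.R i)) = (Pi.single (some i) 1, Pi.single i 1) := by
    intro i
    have h1 : ∀ j, (L.delta (F.R i)).1 ⟨-F.R j, 1⟩ = 0 := fun j =>
      delta_apply_of_not_mem _ fun h => F.add_not_mem j i (by
        rw [← neg_mem_iff, neg_add]
        rwa [sub_eq_add_neg] at h)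
    have h3 : ∀ j, (L.delta (F.R i)).1 ⟨F.R j, 1⟩ = if j = i then 1 else 0 := fun j => by
      split_ifs with hij
      · rw [hij, delta_apply_self]
      · exact delta_apply_of_not_mem _ fun h => hij (F.sub_mem j i h)
    refine Prod.ext (funext fun j => ?_) (funext fun j => ?_)
    · rw [coordFun_fst]
      cases j with
      | none =>
        simp only [point, Option.elim, neg_zero]
        rw [delta_apply_of_not_mem _ (by simpa using F.not_mem i)]
        simp
      | some j => simp [point, h1, h3, Pi.single_apply]
    · simp [coordFun_snd, h1, h3, Pi.single_apply]
  have hm : ∀ i, F.coordFun (L.delta (-F.R i)) = (Pi.single (some i) 1, -Pi.single i 1) := by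
    intro i
    have h1 : ∀ j, (L.delta (-F.R i)).1 ⟨F.R j, 1⟩ = 0 := fun j =>
      delta_apply_of_not_mem _ fun h => F.add_not_mem j i (by rwa [sub_neg_eq_add] at h)
    have h3 : ∀ j, (L.delta (-F.R i)).1 ⟨-F.R j, 1⟩ = if j = i then 1 else 0 := fun j => by
      split_ifs with hij
      · rw [hij, delta_apply_self]
      · refine delta_apply_of_not_mem _ fun h => hij (F.sub_mem j i ?_)
        rw [← neg_mem_iff]
        convert h using 1
        abel
    refine Prod.ext (funext fun j => ?_) (funext fun j => ?_)
    · rw [coordFun_fst]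
      cases j with
      | none =>
        simp only [point, Option.elim, neg_zero]
        rw [delta_apply_of_not_mem _ (by simpa using F.not_mem i)]
        simp
      | some j => simp [point, h1, h3, Pi.single_apply]
    · simp [coordFun_snd, h1, h3, Pi.single_apply]
  set U := LinearMap.range F.coordFun
  have he : ∀ i, ((Pi.single i 1, 0) : SuperSpace (coeffField e n) F.k) ∈ U := by
    intro i
    rw [← U.smul_mem_iff h2]
    cases i with
    | none =>
      refine ⟨_, hz.trans (Prod.ext ?_ (by simp))⟩
      simp [← Pi.single_smul]
    | some i =>
      refine ⟨L.delta (F.R i) + L.delta (-F.R i), ?_⟩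
      rw [map_add, hp, hm]
      refine Prod.ext ?_ (by simp)
      simp [two_smul]
  have ho : ∀ i, ((0, Pi.single i 1) : SuperSpace (coeffField e n) F.k) ∈ U := by
    intro i
    rw [← U.smul_mem_iff h2]
    refine ⟨L.delta (F.R i) - L.delta (-F.R i), ?_⟩
    rw [map_sub, hp, hm]
    refine Prod.ext (by simp) ?_
    simp [two_smul]
  refine Submodule.eq_top_iff'.2 fun x => ?_
  have hx : x = ∑ i, x.1 i • ((Pi.single i 1, 0) : SuperSpace (coeffField e n) F.k) +
      ∑ i, x.2 i • ((0, Pi.single i 1) : SuperSpace (coeffField e n) F.k) := by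
    refine Prod.ext ?_ ?_
    · rw [Prod.fst_add, Prod.fst_sum, Prod.fst_sum]
      simpa [← Pi.single_smul] using (Finset.univ_sum_single x.1).symm
    · rw [Prod.snd_add, Prod.snd_sum, Prod.snd_sum]
      simpa [← Pi.single_smul] using (Finset.univ_sum_single x.2).symm
  rw [hx]
  exact U.add_mem (U.sum_mem fun i _ => U.smul_mem _ (he i))
    (U.sum_mem fun i _ => U.smul_mem _ (ho i))

/-- The coordinates on `ℋ_L` given by a frame. -/
noncomputable def coord (F : L.Frame) :
    L.model ≃ₗ[coeffField e n] SuperSpace (coeffField e n) F.k :=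
  LinearEquiv.ofBijective F.coordFun ⟨F.coordFun_injective, F.coordFun_surjective⟩

theorem coord_flip (F : L.Frame) (φ : L.model) : F.coord (L.flip φ) = parity (F.coord φ) := by
  change F.coordFun (L.flip φ) = parity (F.coordFun φ)
  refine Prod.ext (funext fun i => ?_) (funext fun i => ?_)
  · simp only [parity, coordFun_fst, flip_apply, Heis.sigma, MulEquiv.coe_mk, Equiv.coe_fn_mk,
      neg_neg]
    exact add_comm _ _
  · simp only [parity, coordFun_snd, flip_apply, Heis.sigma, MulEquiv.coe_mk, Equiv.coe_fn_mk,
      neg_neg, Pi.neg_apply]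
    exact (neg_sub _ _).symm

/-- The total dimension `2k + 1` determines `k`. -/
theorem k_eq (F : L.Frame) (F' : L'.Frame) (A : L.model ≃ₗ[coeffField e n] L'.model) :
    F.k = F'.k := by
  have h := ((F.coord.symm.trans A).trans F'.coord).finrank_eq
  simp only [Module.finrank_prod, Module.finrank_fintype_fun_eq_card, Fintype.card_option,
    Fintype.card_fin] at h
  omega

/-- The matrix of a linear map in the coordinates given by two frames. -/
noncomputable def conj (F : L.Frame) (F' : L'.Frame) (A : L.model →ₗ[coeffField e n] L'.model) :
    SuperSpace (coeffField e n) F.k →ₗ[coeffField e n] SuperSpace (coeffField e n) F'.k :=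
  F'.coord.toLinearMap ∘ₗ A ∘ₗ F.coord.symm.toLinearMap

theorem conj_apply (F : L.Frame) (F' : L'.Frame) (A : L.model →ₗ[coeffField e n] L'.model) (x) :
    F.conj F' A x = F'.coord (A (F.coord.symm x)) := rfl

/-- Commuting with the symmetric structures. -/
def CommutesFlip (A : L.model →ₗ[coeffField e n] L'.model) : Prop :=
  ∀ φ, A (L.flip φ) = L'.flip (A φ)

theorem isEven_conj (F : L.Frame) (F' : L'.Frame) {A : L.model →ₗ[coeffField e n] L'.model}
    (hA : CommutesFlip A) : IsEven (F.conj F' A) := fun x => by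
  obtain ⟨φ, rfl⟩ := F.coord.surjective x
  rw [conj_apply, conj_apply, ← F.coord_flip, LinearEquiv.symm_apply_apply,
    LinearEquiv.symm_apply_apply, hA, F'.coord_flip]

theorem conj_comp (F : L.Frame) (F' : L'.Frame) (F'' : L''.Frame)
    (B : L'.model →ₗ[coeffField e n] L''.model) (A : L.model →ₗ[coeffField e n] L'.model) :
    F.conj F'' (B ∘ₗ A) = F'.conj F'' B ∘ₗ F.conj F' A :=
  LinearMap.ext fun x => by
    rw [conj_apply, LinearMap.comp_apply, LinearMap.comp_apply, conj_apply, conj_apply,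
      LinearEquiv.symm_apply_apply]

end Frame

end Lagrangian

end SymplecticModule

end FiniteHeisenberg

/-! ### Intertwiners of Berezinian one and the sign of transport of structure -/

namespace FiniteHeisenberg

namespace SymplecticModule

variable {e : Type v} [Field e] {n : ℕ} {D D' D'' : SymplecticModule.{u} e n} [CharZero e]

namespace Lagrangian

/-- Pullback of functions along `H(f)`. -/
noncomputable def pullback (f : Iso D D') (L : Lagrangian D) :
    (L.map f).model →ₗ[coeffField e n] L.model where
  toFun φ := ⟨fun x => φ.1 (f.heis x), fun l hl a x => by
    change φ.1 (f.heis (_ * x)) = _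
    rw [map_mul]
    exact φ.2 _ ⟨l, hl, rfl⟩ a _⟩
  map_add' _ _ := rfl
  map_smul' _ _ := rfl

theorem pullback_apply (f : Iso D D') (L : Lagrangian D) (φ : (L.map f).model) (x : Heis D) :
    (pullback f L φ).1 x = φ.1 (f.heis x) := rfl

theorem pullback_rep (f : Iso D D') (L : Lagrangian D) (φ : (L.map f).model) (h : Heis D) :
    pullback f L ((L.map f).rep (f.heis h) φ) = L.rep h (pullback f L φ) :=
  Subtype.ext (funext fun x => by
    rw [pullback_apply, rep_apply, rep_apply, pullback_apply, map_mul])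

/-- The factor is the same as for `x` itself, since `β(-x, -m) = β(x, m)`. This lets even and odd
coordinates scale by the same `b` below. -/
theorem model_apply_neg_of_sub_mem (L : Lagrangian D) (φ : L.model) {x m : D.M}
    (h : x - m ∈ L.L) :
    φ.1 ⟨-x, 1⟩ = tautChar e n (D.halfForm x m)⁻¹ * φ.1 ⟨-m, 1⟩ := by
  have h1 : -x - -m ∈ L.L := by
    rw [← neg_mem_iff]
    convert h using 1
    abel
  rw [L.model_apply_of_sub_mem φ h1, halfForm_neg_left, halfForm_neg_right, inv_inv]

/-- Modulo `L`, `x` is `R j` or `-R j`; the second case exchanges the two values and so affects only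
the odd coordinate, by `s = -1`. -/
theorem Frame.exists_coordinate (L : Lagrangian D) (F : L.Frame) {x : D.M} (hx : x ∉ L.L) :
    ∃ (j : Fin F.k) (b : coeffField e n) (s : ℤˣ), b ≠ 0 ∧
      (x - F.R j ∈ L.L ∨ x + F.R j ∈ L.L) ∧
      ∀ φ : L.model, φ.1 ⟨x, 1⟩ + φ.1 ⟨-x, 1⟩ = b * (φ.1 ⟨F.R j, 1⟩ + φ.1 ⟨-F.R j, 1⟩) ∧
        φ.1 ⟨x, 1⟩ - φ.1 ⟨-x, 1⟩ =
          ((s : ℤ) : coeffField e n) * b * (φ.1 ⟨F.R j, 1⟩ - φ.1 ⟨-F.R j, 1⟩) := by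
  obtain ⟨j, hj⟩ := F.exists_mem x hx
  rcases hj with h | h
  · refine ⟨j, tautChar e n (D.halfForm x (F.R j))⁻¹, 1, tautChar_ne_zero _, Or.inl h,
      fun φ => ?_⟩
    rw [L.model_apply_of_sub_mem φ h, L.model_apply_neg_of_sub_mem φ h]
    constructor
    · ring
    · push_cast
      ring
  · refine ⟨j, tautChar e n (D.halfForm x (-F.R j))⁻¹, -1, tautChar_ne_zero _, Or.inr h,
      fun φ => ?_⟩
    have h' : x - -F.R j ∈ L.L := by rwa [sub_neg_eq_add]
    rw [L.model_apply_of_sub_mem φ h', L.model_apply_neg_of_sub_mem φ h', neg_neg]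
    constructor
    · ring
    · push_cast
      ring

/-- Transport of structure along `f` has superdeterminant `±1` in any frames. -/
theorem superDet_pullback (hn : Odd n) (f : Iso D D') (L : Lagrangian D) (F : L.Frame)
    (F' : (L.map f).Frame) :
    ∃ s : ℤˣ, superDet (F'.conj F (pullback f L)) = ((s : ℤ) : coeffField e n) := by
  have hk : F'.k = F.k := by
    obtain ⟨A, -, -⟩ := exists_intertwiner hn f L (L.map f)
    exact (F.k_eq F' A).symm
  choose τ b s hb hτ hφ using fun i => F'.exists_coordinate (L.map f)
    (x := f.toEquiv (F.R i)) (fun h => F.not_mem i ((mem_map_iff f L _).1 h))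
  have hsurj : ∀ x, ∃ φ, F'.coordFun φ = x ∧
      F'.conj F (pullback f L) x = F.coordFun (pullback f L φ) := fun x =>
    ⟨F'.coord.symm x, F'.coord.apply_symm_apply x, rfl⟩
  have hpt : ∀ m, f.heis ⟨m, 1⟩ = ⟨f.toEquiv m, 1⟩ := fun m => rfl
  refine ⟨_, superDet_monomial hk _ τ (fun i j hij => ?_) b hb s (fun x => ?_) (fun x i => ?_)
    fun x i => ?_⟩
  -- If `f(R i)` and `f(R j)` agree up to sign modulo `f(L)`, then so do `R i` and `R j` modulo `L`;
  -- a frame allows this only for `i = j`.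
  · have h1 : f.toEquiv (F.R i - F.R j) ∈ (L.map f).L ∨
        f.toEquiv (F.R i + F.R j) ∈ (L.map f).L := by
      rw [map_sub, map_add]
      have hi := hτ i
      have hj := hτ j
      rw [← hij] at hj
      rcases hi with hi | hi <;> rcases hj with hj | hj
      · exact Or.inl (by convert sub_mem hi hj using 1; abel)
      · exact Or.inr (by convert add_mem hi hj using 1; abel)
      · exact Or.inr (by convert add_mem hi hj using 1; abel)
      · exact Or.inl (by convert sub_mem hi hj using 1; abel)
    rcases h1 with h1 | h1
    · exact F.sub_mem i j ((mem_map_iff f L _).1 h1)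
    · exact absurd ((mem_map_iff f L _).1 h1) (F.add_not_mem i j)
  · obtain ⟨φ, rfl, h⟩ := hsurj x
    rw [h, Frame.coordFun_fst, Frame.coordFun_fst, pullback_apply, pullback_apply, hpt, hpt]
    simp [Frame.point]
  · obtain ⟨φ, rfl, h⟩ := hsurj x
    rw [h, Frame.coordFun_fst, Frame.coordFun_fst, pullback_apply, pullback_apply, hpt, hpt,
      map_neg]
    exact (hφ i φ).1
  · obtain ⟨φ, rfl, h⟩ := hsurj x
    rw [h, Frame.coordFun_snd, Frame.coordFun_snd, pullback_apply, pullback_apply, hpt, hpt,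
      map_neg]
    exact (hφ i φ).2

/-- A chosen frame of a Lagrangian subgroup. -/
noncomputable def frame (hn : Odd n) (L : Lagrangian D) : L.Frame := (L.exists_frame hn).some

/-- Intertwiners compatible with the symmetric structures, of superdeterminant `1` in the chosen
frames. -/
structure IsNormalized (hn : Odd n) (f : Iso D D') {L : Lagrangian D} {L' : Lagrangian D'}
    (A : L.model ≃ₗ[coeffField e n] L'.model) : Prop where
  intertwines : Intertwines f A.toLinearMap
  commutesFlip : Frame.CommutesFlip A.toLinearMap
  superDet_eq : superDet ((L.frame hn).conj (L'.frame hn) A.toLinearMap) = 1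

variable {L : Lagrangian D} {L' : Lagrangian D'} {L'' : Lagrangian D''}

theorem superDet_conj_of_apply_eq_smul (F : L.Frame) (F' : L'.Frame)
    {A : L.model ≃ₗ[coeffField e n] L'.model} {B : L.model →ₗ[coeffField e n] L'.model}
    {c : coeffField e n} (hc : c ≠ 0) (h : ∀ v, B v = c • A v) :
    superDet (F.conj F' B) = c * superDet (F.conj F' A.toLinearMap) :=
  superDet_of_apply_eq_smul (F.k_eq F' A) hc fun x => by
    rw [Frame.conj_apply, h, map_smul]
    rfl

/-- Dividing an even intertwiner by its Berezinian `d` suffices, by homogeneity of degree one. -/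
theorem exists_isNormalized (hn : Odd n) (f : Iso D D') (L : Lagrangian D) (L' : Lagrangian D') :
    ∃ A : L.model ≃ₗ[coeffField e n] L'.model, IsNormalized hn f A := by
  obtain ⟨A, hA, hA'⟩ := exists_intertwiner hn f L L'
  have hA' : Frame.CommutesFlip A.toLinearMap := hA'
  set d := superDet ((L.frame hn).conj (L'.frame hn) A.toLinearMap) with hd
  have hd0 : d ≠ 0 := superDet_ne_zero ((L.frame hn).k_eq (L'.frame hn) A)
    (((L.frame hn).coord.symm.trans A).trans (L'.frame hn).coord)
    ((L.frame hn).isEven_conj (L'.frame hn) hA')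
  let B := A.trans (LinearEquiv.smulOfNeZero (coeffField e n) L'.model d⁻¹ (inv_ne_zero hd0))
  have hB : ∀ v, B v = d⁻¹ • A v := fun v => rfl
  refine ⟨B, fun h v => ?_, fun φ => ?_, ?_⟩
  · have h1 : A (L.rep h v) = L'.rep (f.heis h) (A v) := hA h v
    rw [LinearEquiv.coe_coe, hB, hB, map_smul, h1]
  · have h1 : A (L.flip φ) = L'.flip (A φ) := hA' φ
    rw [LinearEquiv.coe_coe, hB, hB, map_smul, h1]
  · rw [superDet_conj_of_apply_eq_smul _ _ (inv_ne_zero hd0) hB, ← hd, inv_mul_cancel₀ hd0]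

/-- By Schur's lemma the two differ by a scalar `c`, which is also the ratio of their Berezinians,
hence `1`. -/
theorem IsNormalized.apply_eq {hn : Odd n} {f : Iso D D'}
    {A B : L.model ≃ₗ[coeffField e n] L'.model} (hA : IsNormalized hn f A)
    (hB : IsNormalized hn f B) (v : L.model) : B v = A v := by
  obtain ⟨c, hc⟩ := Intertwines.eq_smul hn hA.intertwines hB.intertwines
  have hc0 : c ≠ 0 := fun h0 => L.delta_zero_ne_zero <| by
    have h1 : B (L.delta 0) = c • A (L.delta 0) := hc _
    rwa [h0, zero_smul, LinearEquiv.map_eq_zero_iff] at h1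
  have h1 := superDet_conj_of_apply_eq_smul (L.frame hn) (L'.frame hn) hc0 hc
  rw [hA.superDet_eq, hB.superDet_eq, mul_one] at h1
  exact (hc v).trans (by rw [← h1, one_smul])

theorem IsNormalized.trans {hn : Odd n} {g : Iso D' D''} {f : Iso D D'}
    {A : L.model ≃ₗ[coeffField e n] L'.model} {B : L'.model ≃ₗ[coeffField e n] L''.model}
    (hA : IsNormalized hn f A) (hB : IsNormalized hn g B) :
    IsNormalized hn (g.comp f) (A.trans B) where
  intertwines := hB.intertwines.comp hA.intertwines
  commutesFlip φ := by
    have h1 : A (L.flip φ) = L'.flip (A φ) := hA.commutesFlip φ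
    have h2 : B (L'.flip (A φ)) = L''.flip (B (A φ)) := hB.commutesFlip _
    rw [LinearEquiv.coe_coe, LinearEquiv.trans_apply, LinearEquiv.trans_apply, h1, h2]
  superDet_eq := by
    have h := (L.frame hn).conj_comp (L'.frame hn) (L''.frame hn) B.toLinearMap A.toLinearMap
    have h2 : (A.trans B).toLinearMap = B.toLinearMap ∘ₗ A.toLinearMap := rfl
    rw [h2, h, superDet_comp ((L.frame hn).k_eq (L'.frame hn) A)
      ((L'.frame hn).k_eq (L''.frame hn) B) (Frame.isEven_conj _ _ hA.commutesFlip),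
      hA.superDet_eq, hB.superDet_eq, mul_one]

theorem isNormalized_refl (hn : Odd n) (L : Lagrangian D) :
    IsNormalized hn (Iso.refl D) (LinearEquiv.refl (coeffField e n) L.model) where
  intertwines _ _ := rfl
  commutesFlip _ := rfl
  superDet_eq := by
    have h : (L.frame hn).conj (L.frame hn)
        (LinearEquiv.refl (coeffField e n) L.model).toLinearMap = LinearMap.id :=
      LinearMap.ext fun x => (L.frame hn).coord.apply_symm_apply x
    rw [h, superDet_id]

/-- The normalized intertwiner `ℋ_L → ℋ_L'` over `f`. -/
noncomputable def transport (hn : Odd n) (f : Iso D D') (L : Lagrangian D) (L' : Lagrangian D') :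
    L.model ≃ₗ[coeffField e n] L'.model :=
  (exists_isNormalized hn f L L').choose

theorem transport_isNormalized (hn : Odd n) (f : Iso D D') (L : Lagrangian D)
    (L' : Lagrangian D') : IsNormalized hn f (transport hn f L L') :=
  (exists_isNormalized hn f L L').choose_spec

theorem transport_rep (hn : Odd n) (f : Iso D D') (L : Lagrangian D) (L' : Lagrangian D')
    (h : Heis D) (v : L.model) :
    transport hn f L L' (L.rep h v) = L'.rep (f.heis h) (transport hn f L L' v) :=
  (transport_isNormalized hn f L L').intertwines h v

theorem transport_refl (hn : Odd n) (L : Lagrangian D) (v : L.model) :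
    transport hn (Iso.refl D) L L v = v :=
  (isNormalized_refl hn L).apply_eq (transport_isNormalized hn _ L L) v

/-- Both sides are normalized over `g ∘ f`, so uniqueness turns agreement up to a scalar into
equality. -/
theorem transport_comp (hn : Odd n) (g : Iso D' D'') (f : Iso D D') (L : Lagrangian D)
    (L' : Lagrangian D') (L'' : Lagrangian D'') (v : L.model) :
    transport hn (g.comp f) L L'' v = transport hn g L' L'' (transport hn f L L' v) :=
  ((transport_isNormalized hn f L L').trans (transport_isNormalized hn g L' L'')).apply_eq
    (transport_isNormalized hn _ L L'') v

/-- The normalized intertwiner `ℋ_L → ℋ_{f(L)}` is transport of structure up to sign. -/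
theorem exists_transport_map_apply (hn : Odd n) (f : Iso D D') (L : Lagrangian D) :
    ∃ s : ℤˣ, ∀ (v : L.model) (h : Heis D),
      (transport hn f L (L.map f) v).1 (f.heis h) = ((s : ℤ) : coeffField e n) * v.1 h := by
  obtain ⟨s, hs⟩ := superDet_pullback hn f L (L.frame hn) ((L.map f).frame hn)
  set A := transport hn f L (L.map f)
  have hA : IsNormalized hn f A := transport_isNormalized hn f L (L.map f)
  -- Following `A` by pullback along `f` gives an endomorphism of `ℋ_L`, hence a scalar `c`. Its
  -- Berezinian is `c`, and by multiplicativity also the sign `s` of the pullback.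
  obtain ⟨c, hc⟩ := Intertwines.eq_smul_id hn (L := L) (A := pullback f L ∘ₗ A.toLinearMap)
    fun h v => by
      rw [LinearMap.comp_apply, hA.intertwines h v, pullback_rep]
      rfl
  have hdet : superDet ((L.frame hn).conj (L.frame hn) (pullback f L ∘ₗ A.toLinearMap)) =
      ((s : ℤ) : coeffField e n) := by
    have hk := (L.frame hn).k_eq ((L.map f).frame hn) A
    rw [(L.frame hn).conj_comp ((L.map f).frame hn), superDet_comp hk hk.symm
      (Frame.isEven_conj _ _ hA.commutesFlip), hA.superDet_eq, hs, mul_one]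
  have hc0 : c ≠ 0 := fun h0 => by
    have h1 : pullback f L (A (L.delta 0)) = 0 := by
      have h2 := hc (L.delta 0)
      rwa [h0, zero_smul] at h2
    have h3 : A (L.delta 0) = 0 := Subtype.ext (funext fun x => by
      obtain ⟨x, rfl⟩ := f.heis.surjective x
      exact congrFun (congrArg Subtype.val h1) x)
    exact L.delta_zero_ne_zero (A.map_eq_zero_iff.1 h3)
  have hcs : c = ((s : ℤ) : coeffField e n) := by
    have h1 := superDet_conj_of_apply_eq_smul (L.frame hn) (L.frame hn)
      (A := LinearEquiv.refl (coeffField e n) L.model) hc0 hc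
    rw [hdet, (isNormalized_refl hn L).superDet_eq, mul_one] at h1
    exact h1.symm
  exact ⟨s, fun v h => by
    rw [← hcs]
    exact congrFun (congrArg Subtype.val (hc v)) h⟩

end Lagrangian

/-! ### The canonical representation and its functoriality -/

open Lagrangian

/-- A chosen Lagrangian subgroup. -/
noncomputable def lagrangian (D : SymplecticModule.{u} e n) : Lagrangian D :=
  (exists_lagrangian D).some

/-- Coordinates on the model attached to the chosen Lagrangian subgroup. -/
noncomputable def coord (hn : Odd n) (D : SymplecticModule.{u} e n) :
    D.lagrangian.model ≃ₗ[coeffField e n]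
      SuperSpace (coeffField e n) (D.lagrangian.frame hn).k :=
  (D.lagrangian.frame hn).coord

/-- The model attached to the chosen Lagrangian subgroup, in coordinates. -/
noncomputable def heisRep (hn : Odd n) (D : SymplecticModule.{u} e n) : HeisRep D where
  -- The function space `ℋ_L` involves the universe of `M`; its coordinate space lies in `Type v`,
  -- as `HeisRep` requires.
  V := SuperSpace (coeffField e n) (D.lagrangian.frame hn).k
  ρ :=
    { toFun h := (D.coord hn).toLinearMap ∘ₗ D.lagrangian.rep h ∘ₗ (D.coord hn).symm.toLinearMap
      map_one' := LinearMap.ext fun x => by simp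
      map_mul' h h' := LinearMap.ext fun x => by simp }

/-- The defining isomorphism with the model attached to the chosen Lagrangian subgroup. -/
noncomputable def toModel (hn : Odd n) (D : SymplecticModule.{u} e n) :
    (D.heisRep hn).V ≃ₗ[coeffField e n] D.lagrangian.model :=
  (D.coord hn).symm

theorem toModel_rho (hn : Odd n) (D : SymplecticModule.{u} e n) (h : Heis D)
    (v : (D.heisRep hn).V) :
    D.toModel hn ((D.heisRep hn).ρ h v) = D.lagrangian.rep h (D.toModel hn v) :=
  (D.coord hn).symm_apply_apply _

theorem heisRep_isIrreducible (hn : Odd n) (D : SymplecticModule.{u} e n) :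
    (D.heisRep hn).ρ.IsIrreducible where
  exists_pair_ne := ⟨⊥, ⊤, fun h => D.lagrangian.delta_zero_ne_zero <| by
    have h1 : (D.toModel hn).symm (D.lagrangian.delta 0) ∈
      (⊤ : Subrepresentation (D.heisRep hn).ρ).toSubmodule := Submodule.mem_top
    rw [← h] at h1
    exact (D.toModel hn).symm.map_eq_zero_iff.1 ((Submodule.mem_bot _).1 h1)⟩
  eq_bot_or_eq_top U := by
    have key := D.lagrangian.eq_bot_or_eq_top hn
      (U.toSubmodule.comap (D.toModel hn).symm.toLinearMap) fun h v hv => by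
        rw [Submodule.mem_comap, LinearEquiv.coe_coe] at hv ⊢
        have h1 : (D.toModel hn).symm (D.lagrangian.rep h v) =
            (D.heisRep hn).ρ h ((D.toModel hn).symm v) := by
          rw [LinearEquiv.symm_apply_eq, toModel_rho, LinearEquiv.apply_symm_apply]
        rw [h1]
        exact U.apply_mem_toSubmodule h hv
    refine key.imp (fun h => Subrepresentation.toSubmodule_injective ?_)
      (fun h => Subrepresentation.toSubmodule_injective ?_)
    · refine (Submodule.eq_bot_iff _).2 fun x hx => ?_
      have h1 : D.toModel hn x ∈ U.toSubmodule.comap (D.toModel hn).symm.toLinearMap := by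
        rwa [Submodule.mem_comap, LinearEquiv.coe_coe, LinearEquiv.symm_apply_apply]
      rw [h, Submodule.mem_bot, LinearEquiv.map_eq_zero_iff] at h1
      exact h1
    · refine Submodule.eq_top_iff'.2 fun x => ?_
      have h1 : D.toModel hn x ∈ U.toSubmodule.comap (D.toModel hn).symm.toLinearMap :=
        h ▸ Submodule.mem_top
      rwa [Submodule.mem_comap, LinearEquiv.coe_coe, LinearEquiv.symm_apply_apply] at h1

/-- The canonical lift of a symplectic isomorphism. -/
noncomputable def lift (hn : Odd n) (f : Iso D D') :
    (D.heisRep hn).V ≃ₗ[coeffField e n] (D'.heisRep hn).V :=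
  ((D.toModel hn).trans (transport hn f D.lagrangian D'.lagrangian)).trans (D'.toModel hn).symm

theorem toModel_lift (hn : Odd n) (f : Iso D D') (v : (D.heisRep hn).V) :
    D'.toModel hn (lift hn f v) =
      transport hn f D.lagrangian D'.lagrangian (D.toModel hn v) :=
  (D'.toModel hn).apply_symm_apply _

theorem lift_rho (hn : Odd n) (f : Iso D D') (h : Heis D) (v : (D.heisRep hn).V) :
    lift hn f ((D.heisRep hn).ρ h v) = (D'.heisRep hn).ρ (f.heis h) (lift hn f v) := by
  apply (D'.toModel hn).injective
  rw [toModel_lift, toModel_rho, toModel_rho, toModel_lift, transport_rep]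

theorem lift_refl (hn : Odd n) (D : SymplecticModule.{u} e n) (v : (D.heisRep hn).V) :
    lift hn (Iso.refl D) v = v := by
  apply (D.toModel hn).injective
  rw [toModel_lift, transport_refl]

theorem lift_comp (hn : Odd n) (g : Iso D' D'') (f : Iso D D') (v : (D.heisRep hn).V) :
    lift hn (g.comp f) v = lift hn g (lift hn f v) := by
  apply (D''.toModel hn).injective
  rw [toModel_lift, toModel_lift, toModel_lift, transport_comp]

/-- The canonical isomorphisms with the models. -/
noncomputable def modelEquiv (hn : Odd n) (D : SymplecticModule.{u} e n) (L : Lagrangian D) :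
    (D.heisRep hn).V ≃ₗ[coeffField e n] L.model :=
  (D.toModel hn).trans (transport hn (Iso.refl D) D.lagrangian L)

theorem modelEquiv_rho (hn : Odd n) (D : SymplecticModule.{u} e n) (L : Lagrangian D)
    (h : Heis D) (v : (D.heisRep hn).V) :
    D.modelEquiv hn L ((D.heisRep hn).ρ h v) = L.rep h (D.modelEquiv hn L v) := by
  rw [modelEquiv, LinearEquiv.trans_apply, LinearEquiv.trans_apply, toModel_rho, transport_rep]
  rfl

/-- Both sides are the normalized intertwiner over `f` from the chosen model of `D` to that of
`f(L)`, so the sign in (ii) is that of `transport hn f L (L.map f)`. -/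
theorem modelEquiv_map_lift (hn : Odd n) (f : Iso D D') (L : Lagrangian D)
    (v : (D.heisRep hn).V) :
    D'.modelEquiv hn (L.map f) (lift hn f v) =
      transport hn f L (L.map f) (D.modelEquiv hn L v) := by
  rw [modelEquiv, modelEquiv, LinearEquiv.trans_apply, LinearEquiv.trans_apply, toModel_lift,
    ← transport_comp, ← transport_comp]
  rfl

theorem rho_incl (hn : Odd n) (D : SymplecticModule.{u} e n) (a : rootsOfUnity n e)
    (v : (D.heisRep hn).V) :
    (D.heisRep hn).ρ (Heis.incl D a) v = tautChar e n a • v := by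
  apply (D.toModel hn).injective
  rw [toModel_rho, map_smul]
  refine Subtype.ext (funext fun x => ?_)
  have h : x * Heis.incl D a = ⟨0, a⟩ * x := by
    ext1 <;> simp [Heis.incl, halfForm_zero_left, halfForm_zero_right, mul_comm]
  rw [rep_apply, h]
  exact (D.toModel hn v).2 0 (zero_mem _) a x

/-- The action of `H ⋊ Sp(M)`. -/
noncomputable def semidirectRep (hn : Odd n) (D : SymplecticModule.{u} e n) :
    Representation (coeffField e n) (Heis D ⋊[spAction D] Sp D) (D.heisRep hn).V where
  toFun x := (D.heisRep hn).ρ x.left ∘ₗ (lift hn x.right).toLinearMap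
  map_one' := LinearMap.ext fun v => by
    change (D.heisRep hn).ρ 1 (lift hn (Iso.refl D) v) = v
    rw [lift_refl, map_one]
    rfl
  map_mul' x y := LinearMap.ext fun v => by
    change (D.heisRep hn).ρ (x.left * x.right.heis y.left)
      (lift hn (x.right.comp y.right) v) = (D.heisRep hn).ρ x.left (lift hn x.right
        ((D.heisRep hn).ρ y.left (lift hn y.right v)))
    rw [lift_comp, lift_rho, map_mul]
    rfl

end SymplecticModule

end FiniteHeisenberg

/-! ### The theorem -/

open FiniteHeisenberg SymplecticModule in
theorem theorem1 {e : Type v} [Field e] [IsAlgClosed e] [CharZero e] (n : ℕ) (hn : Odd n) :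
    ∃ (π : ∀ D : SymplecticModule.{u} e n, HeisRep D)
      (T : ∀ {D D' : SymplecticModule.{u} e n}, Iso D D' → (π D).V ≃ₗ[coeffField e n] (π D').V)
      (t : ∀ (D : SymplecticModule.{u} e n) (L : Lagrangian D),
        (π D).V ≃ₗ[coeffField e n] L.model),
      -- each `π D` is irreducible with central character `ι`
      (∀ D, (π D).ρ.IsIrreducible) ∧
      (∀ D (a : rootsOfUnity n e) (v : (π D).V),
        (π D).ρ (Heis.incl D a) v = tautChar e n a • v) ∧
      -- functoriality: every symplectic isomorphism has a distinguished lift, compatibly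
      (∀ {D D' : SymplecticModule.{u} e n} (f : Iso D D') (h : Heis D) (v : (π D).V),
        T f ((π D).ρ h v) = (π D').ρ (f.heis h) (T f v)) ∧
      (∀ (D : SymplecticModule.{u} e n) (v : (π D).V), T (Iso.refl D) v = v) ∧
      (∀ {D D' D'' : SymplecticModule.{u} e n} (g : Iso D' D'') (f : Iso D D') (v : (π D).V),
        T (g.comp f) v = T g (T f v)) ∧
      -- the isomorphisms `± t L` with the models `ℋ_L` are `H`-equivariant and natural up to sign
      (∀ (D : SymplecticModule.{u} e n) (L : Lagrangian D) (h x : Heis D) (v : (π D).V),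
        (t D L ((π D).ρ h v) : Heis D → coeffField e n) x =
          (t D L v : Heis D → coeffField e n) (x * h)) ∧
      (∀ {D D' : SymplecticModule.{u} e n} (f : Iso D D') (L : Lagrangian D),
        ∃ s : ℤˣ, ∀ (v : (π D).V) (h : Heis D),
          (t D' (L.map f) (T f v) : Heis D' → coeffField e n) (f.heis h) =
            ((s : ℤ) : coeffField e n) * (t D L v : Heis D → coeffField e n) h) ∧
      -- the action of `H` on `π D` extends to `H ⋊ Sp(M)`, with `g ∈ Sp(M)` acting by `T g`
      (∀ D : SymplecticModule.{u} e n,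
        ∃ ρ' : Representation (coeffField e n) (Heis D ⋊[spAction D] Sp D) (π D).V,
          (∀ h : Heis D, ρ' (SemidirectProduct.inl h) = (π D).ρ h) ∧
          ∀ (g : Sp D) (v : (π D).V), ρ' (SemidirectProduct.inr g) v = T g v) := by
  refine ⟨heisRep hn, lift hn, modelEquiv hn, heisRep_isIrreducible hn, rho_incl hn,
    lift_rho hn, lift_refl hn, lift_comp hn, fun D L h x v => ?_, fun {D D'} f L => ?_,
    fun D => ⟨semidirectRep hn D, fun h => LinearMap.ext fun v => ?_, fun g v => ?_⟩⟩
  · rw [modelEquiv_rho]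
    rfl
  · obtain ⟨s, hs⟩ := Lagrangian.exists_transport_map_apply hn f L
    exact ⟨s, fun v h => by rw [modelEquiv_map_lift, hs]⟩
  · exact congrArg ((D.heisRep hn).ρ h) (lift_refl hn D v)
  · change (D.heisRep hn).ρ 1 (lift hn g v) = lift hn g v
    rw [map_one]
    rfl
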